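/- For a commutative ring $R$ of prime characteristic $p$ and an integer $e>0$, let $F^e_*R$ denote $R$ viewed as an $R$-module via the $e$-th iterate of Frobenius, i.e. $r\cdot F^e_*x = F^e_*(r^{p^e}x)$. An integral domain $R$ of characteristic $p>0$ (not assumed Noetherian or $F$-finite) is called split-$F$-regular if for every $c\in R\setminus\{0\}$ there is an integer $e>0$ such that the $R$-linear map $R\to F^e_*R$, $1\mapsto F^e_*c$, splits as a map of $R$-modules. Let $S$ be a submonoid of a free abelian group $L$ of finite rank. Let $k$ be a field of characteristic $p>0$ such that the monoid algebra $k[S]$ is split-$F$-regular. Then for every prime number $q$ and every field $K$ of characteristic $q$, the monoid algebra $K[S]$ is Noetherian and split-$F$-regular. -/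

import Mathlib

/-- `F^e_* R`: a copy of the ring `R` of characteristic `p`, regarded as an `R`-module by
restriction of scalars along the `e`-th iterate of the Frobenius `r ↦ r ^ p ^ e`. -/
def FrobeniusPushforward (R : Type*) (_p _e : ℕ) : Type _ := R

namespace FrobeniusPushforward

instance (R : Type*) [CommRing R] (p e : ℕ) : AddCommGroup (FrobeniusPushforward R p e) :=
  inferInstanceAs (AddCommGroup R)

/-- The additive bijection `R → F^e_* R`, `x ↦ F^e_* x`. -/
def of {R : Type*} [CommRing R] (p e : ℕ) : R ≃+ FrobeniusPushforward R p e :=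
  AddEquiv.refl R

noncomputable instance (R : Type*) [CommRing R] (p e : ℕ) [Fact p.Prime] [CharP R p] :
    Module R (FrobeniusPushforward R p e) :=
  Module.compHom R (iterateFrobenius R p e)

theorem smul_of {R : Type*} [CommRing R] (p e : ℕ) [Fact p.Prime] [CharP R p] (r x : R) :
    r • of p e x = of p e (r ^ p ^ e * x) :=
  rfl

end FrobeniusPushforward

/-- The unique `R`-linear map `R → F^e_* R` that sends `1` to `F^e_* c`. -/
noncomputable def frobeniusLambda {R : Type*} [CommRing R] (p : ℕ) [Fact p.Prime] [CharP R p]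
    (c : R) (e : ℕ) : R →ₗ[R] FrobeniusPushforward R p e :=
  LinearMap.toSpanSingleton R (FrobeniusPushforward R p e) (FrobeniusPushforward.of p e c)

/-- A ring `R` of prime characteristic `p` is split-`F`-regular if it is an integral domain and
for every `c ≠ 0` there is `e > 0` such that the `R`-linear map `R → F^e_* R`, `1 ↦ F^e_* c`,
has an `R`-linear left inverse. Neither Noetherianity nor `F`-finiteness is assumed. -/
structure IsSplitFRegular (R : Type*) [CommRing R] (p : ℕ) [Fact p.Prime] [CharP R p] : Prop where
  isDomain : IsDomain R
  exists_splitting : ∀ c : R, c ≠ 0 → ∃ e : ℕ, 0 < e ∧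
    ∃ φ : FrobeniusPushforward R p e →ₗ[R] R, φ ∘ₗ frobeniusLambda p c e = LinearMap.id

/-- A monoid algebra over a field of characteristic `p` has characteristic `p`. -/
instance AddMonoidAlgebra.charP_of_field (k : Type*) [Field k] (p : ℕ) [CharP k p]
    (S : Type*) [AddCommMonoid S] : CharP (AddMonoidAlgebra k S) p :=
  charP_of_injective_algebraMap (algebraMap k (AddMonoidAlgebra k S)).injective p

/-! Split-F-regularity of k[S] amounts to a condition on S in which the characteristic has
disappeared: each s ∈ S admits some N > 0 with `RootClosedAt`. A splitting of 1 ↦ x^s must send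
x^(p^e u + s) to x^u, so x^u lies in k[S] (`IsSplitFRegular.exists_rootClosedAt`). Conversely, N can
be enlarged to a high power q^e, and keeping only the exponents q^e u + s then gives a K[S]-linear
splitting (`exists_frobenius_splitting`).

The condition also forces S to be finitely generated (`fg_of_rootClosedAt`). For long w ∈ S,
Dirichlet approximation gives a lattice point u close to (n/M)w with 0 < n < M. Root closure at an
interior point of S absorbs the error, so u and w - u both lie in S, and both are shorter than w. -/

/-- The submonoid `S` absorbs `N`-th roots of its elements up to the shift `s`: every `u` in the
group generated by `S` with `N • u + s ∈ S` lies in `S`. -/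
def AddSubmonoid.RootClosedAt {L : Type*} [AddCommGroup L] (S : AddSubmonoid L) (s : L) (N : ℕ) :
    Prop :=
  ∀ u ∈ AddSubgroup.closure (S : Set L), N • u + s ∈ S → u ∈ S

namespace AddSubmonoid

/-! ### Normality and monotonicity from root closure -/

section RootClosed

variable {L : Type*} [AddCommGroup L] {S : AddSubmonoid L}

theorem exists_sub_of_mem_closure {u : L} (hu : u ∈ AddSubgroup.closure (S : Set L)) :
    ∃ a ∈ S, ∃ b ∈ S, u = a - b := by
  induction hu using AddSubgroup.closure_induction with
  | mem x hx => exact ⟨x, hx, 0, S.zero_mem, by simp⟩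
  | zero => exact ⟨0, S.zero_mem, 0, S.zero_mem, by simp⟩
  | add x y _ _ hx hy =>
    obtain ⟨a, ha, b, hb, rfl⟩ := hx
    obtain ⟨c, hc, d, hd, rfl⟩ := hy
    exact ⟨a + c, S.add_mem ha hc, b + d, S.add_mem hb hd, by abel⟩
  | neg x _ hx =>
    obtain ⟨a, ha, b, hb, rfl⟩ := hx
    exact ⟨b, hb, a, ha, by abel⟩

/-- Normality. With u = a - b, s = n•b and N = dn + r, the element N•u + s equals d•(n•u) + r•a + (n
- r)•b. -/
theorem mem_of_nsmul_mem (hS : ∀ s ∈ S, ∃ N, 0 < N ∧ S.RootClosedAt s N) {n : ℕ} (hn : 0 < n)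
    {u : L} (hu : u ∈ AddSubgroup.closure (S : Set L)) (hnu : n • u ∈ S) : u ∈ S := by
  obtain ⟨a, ha, b, hb, rfl⟩ := exists_sub_of_mem_closure hu
  obtain ⟨N, -, hN⟩ := hS (n • b) (S.nsmul_mem hb n)
  refine hN _ hu ?_
  obtain ⟨c, hc⟩ := Nat.exists_eq_add_of_le (Nat.mod_lt N hn).le
  have key (d r c : ℕ) : ((r + c) * d + r) • (a - b) + (r + c) • b
      = d • ((r + c) • (a - b)) + (r • a + c • b) := by module
  have := key (N / n) (N % n) c
  rw [← hc, Nat.div_add_mod] at this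
  rw [this]
  exact S.add_mem (S.nsmul_mem hnu _) (S.add_mem (S.nsmul_mem ha _) (S.nsmul_mem hb _))

/-- Normality cancels the factor M in M(Nu + s) = N(Mu + s) + (M - N)s. -/
theorem RootClosedAt.mono (hS : ∀ s ∈ S, ∃ N, 0 < N ∧ S.RootClosedAt s N) {s : L} (hs : s ∈ S)
    {N M : ℕ} (hM : 0 < M) (hNM : N ≤ M) (h : S.RootClosedAt s N) : S.RootClosedAt s M := by
  intro u hu hMu
  refine h u hu (mem_of_nsmul_mem hS hM ?_ ?_)
  · exact add_mem (nsmul_mem hu _) (AddSubgroup.subset_closure hs)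
  · obtain ⟨c, rfl⟩ := Nat.exists_eq_add_of_le hNM
    have key : (N + c) • (N • u + s) = N • ((N + c) • u + s) + c • s := by module
    rw [key]
    exact S.add_mem (S.nsmul_mem hMu _) (S.nsmul_mem hs _)

end RootClosed

/-! ### Diophantine approximation and finite generation -/

/-- Dirichlet's simultaneous approximation theorem for a rational vector `w / M`, where the
denominator `M` depends only on the precision `Q` and the dimension. -/
theorem _root_.exists_simultaneous_approximation {ι : Type*} [Fintype ι] (Q : ℕ) (hQ : 0 < Q) :
    ∃ M : ℕ, 0 < M ∧ ∀ w : ι → ℤ, ∃ n : ℕ, 0 < n ∧ n < M ∧ ∃ u : ι → ℤ,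
      ∀ i, |M * u i - n * w i| * Q ≤ M := by
  classical
  -- Pigeonhole: the M vectors j•w mod M fall into Q^d boxes of side M/Q, one fewer than M; n is the
  -- difference of two indices sharing a box.
  refine ⟨Q ^ Fintype.card ι + 1, by positivity, fun w => ?_⟩
  set M := Q ^ Fintype.card ι + 1 with hM
  have hM0 : (0 : ℤ) < M := by positivity
  have hbox (j : Fin M) (i : ι) : (((j : ℤ) * w i) % M * Q / M).toNat < Q := by
    have h1 := Int.emod_nonneg ((j : ℤ) * w i) hM0.ne'
    have h2 := Int.emod_lt_of_pos ((j : ℤ) * w i) hM0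
    have h3 : ((j : ℤ) * w i) % M * Q / M < Q := by
      rw [Int.ediv_lt_iff_lt_mul hM0, mul_comm]
      exact mul_lt_mul_of_pos_left h2 (by exact_mod_cast hQ)
    omega
  obtain ⟨j, j', hjj, hf⟩ := Fintype.exists_ne_map_eq_of_card_lt
    (fun (j : Fin M) (i : ι) => (⟨_, hbox j i⟩ : Fin Q)) (by simp [hM])
  wlog hlt : j < j' generalizing j j'
  · exact this j' j hjj.symm hf.symm (lt_of_le_of_ne (not_lt.1 hlt) hjj.symm)
  have hlt' : (j : ℕ) < j' := hlt
  refine ⟨j' - j, by omega, by omega, fun i => (j' * w i) / M - (j * w i) / M, fun i => ?_⟩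
  have hfi := congrArg Fin.val (congrFun hf i)
  simp only at hfi
  have p1 : 0 ≤ ((j : ℤ) * w i) % M * Q / M := Int.ediv_nonneg
    (mul_nonneg (Int.emod_nonneg _ hM0.ne') (by positivity)) hM0.le
  have p2 : 0 ≤ ((j' : ℤ) * w i) % M * Q / M := Int.ediv_nonneg
    (mul_nonneg (Int.emod_nonneg _ hM0.ne') (by positivity)) hM0.le
  have hdiv : ((j : ℤ) * w i) % M * Q / M = ((j' : ℤ) * w i) % M * Q / M := by omega
  have e1 := Int.mul_ediv_add_emod ((j : ℤ) * w i) M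
  have e2 := Int.mul_ediv_add_emod ((j' : ℤ) * w i) M
  have d1 := Int.mul_ediv_add_emod (((j : ℤ) * w i) % M * Q) M
  have d2 := Int.mul_ediv_add_emod (((j' : ℤ) * w i) % M * Q) M
  have l1 := Int.emod_lt_of_pos (((j : ℤ) * w i) % M * Q) hM0
  have l2 := Int.emod_lt_of_pos (((j' : ℤ) * w i) % M * Q) hM0
  have n1 := Int.emod_nonneg (((j : ℤ) * w i) % M * Q) hM0.ne'
  have n2 := Int.emod_nonneg (((j' : ℤ) * w i) % M * Q) hM0.ne'
  rw [hdiv] at d1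
  have hQ' : (0 : ℤ) ≤ Q := by positivity
  rw [← abs_of_nonneg hQ', ← abs_mul, Nat.cast_sub hlt'.le,
    show ((M : ℤ) * (j' * w i / M - j * w i / M) - ((j' : ℕ) - (j : ℕ) : ℤ) * w i) * Q
      = (j * w i) % M * Q - (j' * w i) % M * Q by
        linear_combination (e2 - e1) * (Q : ℤ), abs_le]
  constructor <;> linarith

section Finite

variable {G : Type*} [AddCommGroup G] {ι : Type*} [Fintype ι]

theorem _root_.Module.Basis.finite_sum_natAbs_repr_le (b : Module.Basis ι ℤ G) (R : ℕ) :
    {w : G | ∑ i, (b.repr w i).natAbs ≤ R}.Finite := by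
  have hfin : (Set.univ.pi fun _ : ι => Set.Icc (-(R : ℤ)) R).Finite :=
    Set.Finite.pi fun _ => Set.finite_Icc _ _
  refine (hfin.preimage (b.equivFun.injective.injOn)).subset fun w hw i _ => ?_
  have := (Finset.single_le_sum (f := fun i => (b.repr w i).natAbs) (fun _ _ => Nat.zero_le _)
    (Finset.mem_univ i)).trans hw
  simp only [Module.Basis.equivFun_apply, Set.mem_Icc]
  omega

theorem fg_of_decompose {S : AddSubmonoid G} (f : G → ℕ) (R : ℕ) (hfin : {w | f w ≤ R}.Finite)
    (h : ∀ w ∈ S, R < f w → ∃ u ∈ S, w - u ∈ S ∧ f u < f w ∧ f (w - u) < f w) : S.FG := by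
  rw [AddSubmonoid.fg_iff]
  refine ⟨{w | w ∈ S ∧ f w ≤ R}, le_antisymm ?_ ?_, hfin.subset fun w hw => hw.2⟩
  · exact (AddSubmonoid.closure_le).2 fun w hw => hw.1
  · intro w hw
    induction hn : f w using Nat.strong_induction_on generalizing w with
    | _ n ih =>
      subst hn
      by_cases hR : f w ≤ R
      · exact AddSubmonoid.subset_closure ⟨hw, hR⟩
      · obtain ⟨u, hu, hwu, h1, h2⟩ := h w hw (not_le.1 hR)
        rw [← add_sub_cancel u w]
        exact add_mem (ih _ h1 hu rfl) (ih _ h2 hwu rfl)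

theorem nsmul_add_mem_of_sum_natAbs_repr_le (b : Module.Basis ι ℤ G) {S : AddSubmonoid G} {s : G} (hs : s ∈ S)
    (hadd : ∀ i, s + b i ∈ S) (hsub : ∀ i, s - b i ∈ S) {m : ℕ} {r : G}
    (hr : ∑ i, (b.repr r i).natAbs ≤ m) : m • s + r ∈ S := by
  have hi (i : ι) : (b.repr r i).natAbs • s + b.repr r i • b i ∈ S := by
    obtain ⟨n, hn | hn⟩ := Int.eq_nat_or_neg (b.repr r i)
    · rw [hn, Int.natAbs_natCast, natCast_zsmul, ← nsmul_add]
      exact S.nsmul_mem (hadd i) n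
    · rw [hn, Int.natAbs_neg, Int.natAbs_natCast, neg_smul, natCast_zsmul, ← sub_eq_add_neg,
        ← nsmul_sub]
      exact S.nsmul_mem (hsub i) n
  have key : m • s + r = (m - ∑ i, (b.repr r i).natAbs) • s
      + ∑ i, ((b.repr r i).natAbs • s + b.repr r i • b i) := by
    rw [Finset.sum_add_distrib, b.sum_repr, Finset.sum_nsmul_assoc, ← add_assoc, ← add_nsmul,
      Nat.sub_add_cancel hr]
  rw [key]
  exact S.add_mem (S.nsmul_mem hs _) (S.sum_mem fun i _ => hi i)

theorem fg_of_rootClosedAt_of_basis (b : Module.Basis ι ℤ G) {S : AddSubmonoid G}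
    (htop : AddSubgroup.closure (S : Set G) = ⊤)
    (hS : ∀ s ∈ S, ∃ N, 0 < N ∧ S.RootClosedAt s N) : S.FG := by
  have hmem (u : G) : u ∈ AddSubgroup.closure (S : Set G) := htop ▸ AddSubgroup.mem_top u
  choose x hx y hy hxy using fun i => exists_sub_of_mem_closure (hmem (b i))
  have hxyS (i : ι) : x i + y i ∈ S := S.add_mem (hx i) (hy i)
  -- An interior point: s ± b i ∈ S for all i, so S contains the ℓ¹-ball of radius m about m•s.
  set s := ∑ i, (x i + y i) with hs_def
  have hs : s ∈ S := S.sum_mem fun i _ => hxyS i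
  have hsplit (i : ι) : ∃ t ∈ S, s = t + (x i + y i) := by
    classical
    exact ⟨_, S.sum_mem fun j (_ : j ∈ Finset.univ.erase i) => hxyS j,
      (Finset.sum_erase_add _ _ (Finset.mem_univ i)).symm⟩
  have hadd (i : ι) : s + b i ∈ S := by
    obtain ⟨t, ht, e⟩ := hsplit i
    rw [e, hxy i, show t + (x i + y i) + (x i - y i) = t + (x i + x i) by abel]
    exact S.add_mem ht (S.add_mem (hx i) (hx i))
  have hsub (i : ι) : s - b i ∈ S := by
    obtain ⟨t, ht, e⟩ := hsplit i
    rw [e, hxy i, show t + (x i + y i) - (x i - y i) = t + (y i + y i) by abel]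
    exact S.add_mem ht (S.add_mem (hy i) (hy i))
  obtain ⟨N, hN0, hN⟩ := hS s hs
  -- With d coordinates, precision dN + 1 makes the total ℓ¹ error at most M/N.
  obtain ⟨M, hM0, hM⟩ := exists_simultaneous_approximation (ι := ι)
    (Fintype.card ι * N + 1) (by positivity)
  refine fg_of_decompose (fun w => ∑ i, (b.repr w i).natAbs) M (b.finite_sum_natAbs_repr_le M)
    fun w hw hMw => ?_
  obtain ⟨n, hn0, hnM, v, hv⟩ := hM (b.repr w)
  set u : G := b.equivFun.symm v with hu_def
  have hu (i : ι) : b.repr u i = v i := by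
    rw [hu_def, ← b.equivFun_apply, LinearEquiv.apply_symm_apply]
  have hvi (i : ι) : (M * v i - n * b.repr w i).natAbs * (Fintype.card ι * N + 1) ≤ M := by
    have := hv i
    rw [Int.abs_eq_natAbs] at this
    exact_mod_cast this
  have hsum : (∑ i, (M * v i - n * b.repr w i).natAbs) * N ≤ M := by
    have h1 := Finset.sum_le_sum fun i (_ : i ∈ Finset.univ) => hvi i
    rw [← Finset.sum_mul, Finset.sum_const, Finset.card_univ, smul_eq_mul] at h1
    set T := ∑ i, (M * v i - n * b.repr w i).natAbs
    by_contra hlt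
    push Not at hlt
    have h2 : T * (Fintype.card ι * N + 1) = Fintype.card ι * (T * N) + T := by ring
    have h3 := Nat.mul_le_mul_left (Fintype.card ι) hlt.le
    have hT : T ≤ 0 := by omega
    simp [Nat.le_zero.1 hT] at hlt
  have hsum' : ∑ i, (M * v i - n * b.repr w i).natAbs ≤ M :=
    (Nat.le_mul_of_pos_right _ hN0).trans hsum
  -- M|c| ≤ M + l|w| ≤ M + (M - 1)|w| < M|w|, because |w| > M.
  have hdescent (c c' : ι → ℤ) (hc' : ∑ i, (c' i).natAbs = ∑ i, (b.repr w i).natAbs) (l : ℕ)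
      (hl : l < M) (h : ∑ i, (M * c i - l * c' i).natAbs ≤ M) :
      ∑ i, (c i).natAbs < ∑ i, (b.repr w i).natAbs := by
    have h1 : M * ∑ i, (c i).natAbs ≤ M + l * ∑ i, (c' i).natAbs := by
      refine le_trans ?_ (Nat.add_le_add_right h _)
      rw [Finset.mul_sum, Finset.mul_sum, ← Finset.sum_add_distrib]
      refine Finset.sum_le_sum fun i _ => ?_
      have := Int.natAbs_add_le (M * c i - l * c' i) (l * c' i)
      rwa [sub_add_cancel, Int.natAbs_mul, Int.natAbs_mul, Int.natAbs_natCast,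
        Int.natAbs_natCast] at this
    rw [hc'] at h1
    have h2 := Nat.mul_le_mul_right (∑ i, (b.repr w i).natAbs) (Nat.le_sub_one_of_lt hl)
    rw [Nat.sub_mul, one_mul] at h2
    have h3 : ∑ i, (b.repr w i).natAbs ≤ M * ∑ i, (b.repr w i).natAbs :=
      Nat.le_mul_of_pos_left _ hM0
    refine lt_of_mul_lt_mul_left (a := M) ?_ (Nat.zero_le _)
    omega
  have hmemS (z : G) (l : ℕ) (hz : ∑ i, (M * b.repr z i - l * b.repr w i).natAbs * N ≤ M) :
      z ∈ S := by
    refine hN z (hmem z) (mem_of_nsmul_mem hS hM0 (hmem _) ?_)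
    -- The error N(Mz - lw) has length at most M, so M•s absorbs it. Normality then removes M, and
    -- root closure removes N.
    have key : M • (N • z + s) = (N * l) • w + (M • s + N • (M • z - l • w)) := by
      simp only [nsmul_add, nsmul_sub, mul_nsmul', nsmul_left_comm z N]
      abel
    rw [key]
    refine S.add_mem (S.nsmul_mem hw _) (nsmul_add_mem_of_sum_natAbs_repr_le b hs hadd hsub ?_)
    refine le_of_eq_of_le (Finset.sum_congr rfl fun i _ => ?_) hz
    simp [Int.natAbs_mul, mul_comm]
  have hneg (i : ι) : (M * b.repr (w - u) i - (M - n : ℕ) * b.repr w i).natAbs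
      = (M * v i - n * b.repr w i).natAbs := by
    rw [← Int.natAbs_neg, Nat.cast_sub hnM.le, map_sub, Finsupp.sub_apply, hu]
    ring_nf
  refine ⟨u, hmemS u n ?_, hmemS (w - u) (M - n) ?_, ?_, ?_⟩
  · simpa only [hu, ← Finset.sum_mul] using hsum
  · simpa only [hneg, ← Finset.sum_mul] using hsum
  · exact hdescent _ (b.repr w) rfl n hnM (by simpa only [hu] using hsum')
  · exact hdescent _ (b.repr w) rfl (M - n) (by omega) (by simpa only [hneg] using hsum')

end Finite

theorem fg_of_rootClosedAt {L : Type*} [AddCommGroup L] [Module.Free ℤ L] [Module.Finite ℤ L]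
    {S : AddSubmonoid L} (hS : ∀ s ∈ S, ∃ N, 0 < N ∧ S.RootClosedAt s N) : S.FG := by
  set G := AddSubgroup.closure (S : Set L) with hG
  have hmap : (S.comap G.subtype).map G.subtype = S := by
    rw [AddSubmonoid.map_comap_eq, inf_eq_left]
    intro x hx
    exact ⟨⟨x, AddSubgroup.subset_closure hx⟩, rfl⟩
  have htop : AddSubgroup.closure ((S.comap G.subtype : AddSubmonoid G) : Set G) = ⊤ := by
    exact AddSubgroup.closure_closure_coe_preimage
  have hfg : (S.comap G.subtype).FG := by
    have : Module.Free ℤ G := inferInstanceAs (Module.Free ℤ (AddSubgroup.toIntSubmodule G))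
    have : Module.Finite ℤ G := inferInstanceAs (Module.Finite ℤ (AddSubgroup.toIntSubmodule G))
    refine fg_of_rootClosedAt_of_basis (Module.Free.chooseBasis ℤ G) htop fun s hs => ?_
    obtain ⟨N, hN0, hN⟩ := hS s hs
    exact ⟨N, hN0, fun u _ hu => hN u u.2 hu⟩
  exact hmap ▸ hfg.map G.subtype

end AddSubmonoid

/-! ### From a splitting to root closure -/

open AddMonoidAlgebra

theorem FrobeniusPushforward.exists_map_smul_eq {R : Type*} [CommRing R] {p : ℕ} [Fact p.Prime]
    [CharP R p] {c : R} {e : ℕ} (φ : FrobeniusPushforward R p e →ₗ[R] R)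
    (hφ : φ ∘ₗ frobeniusLambda p c e = LinearMap.id) (r : R) :
    φ (FrobeniusPushforward.of p e (r ^ p ^ e * c)) = r := by
  have := LinearMap.congr_fun hφ r
  simpa [frobeniusLambda, FrobeniusPushforward.smul_of] using this

theorem IsSplitFRegular.exists_rootClosedAt {L : Type*} [AddCommGroup L] {S : AddSubmonoid L}
    {p : ℕ} [Fact p.Prime] {k : Type*} [Field k] [CharP k p]
    (h : IsSplitFRegular (AddMonoidAlgebra k S) p) (s : L) (hs : s ∈ S) :
    ∃ N, 0 < N ∧ S.RootClosedAt s N := by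
  obtain ⟨e, -, φ, hφ⟩ := h.exists_splitting (single (⟨s, hs⟩ : S) 1) (by simp)
  refine ⟨p ^ e, pow_pos (Fact.out : p.Prime).pos e, fun u hu hus => ?_⟩
  obtain ⟨a, ha, b, hb, rfl⟩ := AddSubmonoid.exists_sub_of_mem_closure hu
  set f := φ (FrobeniusPushforward.of p e (single (⟨_, hus⟩ : S) 1)) with hf
  have key : single (⟨b, hb⟩ : S) (1 : k) * f = single (⟨a, ha⟩ : S) 1 := by
    rw [hf, ← smul_eq_mul, ← map_smul, FrobeniusPushforward.smul_of,
      ← FrobeniusPushforward.exists_map_smul_eq φ hφ (single (⟨a, ha⟩ : S) 1)]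
    congr 2
    rw [single_pow, single_pow, single_mul_single, single_mul_single]
    congr 1
    · apply Subtype.ext
      change p ^ e • b + (p ^ e • (a - b) + s) = p ^ e • a + s
      rw [nsmul_sub]
      abel
  by_contra hab
  -- If a - b ∉ S, no exponent d ∈ S satisfies b + d = a, so x^b f has no x^a term, contradicting
  -- x^b f = x^a.
  have hzero := AddMonoidAlgebra.coeff_single_mul_of_forall_add_ne (m := (⟨b, hb⟩ : S))
    (m' := (⟨a, ha⟩ : S)) (1 : k) f fun d hd => hab <| by
      have : b + d = a := congrArg Subtype.val hd
      rw [← this, add_sub_cancel_left]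
      exact d.2
  rw [key] at hzero
  simp at hzero

/-! ### From root closure to splittings in characteristic q -/

/-- A `p ^ e`-inverse-linear functional on a field `K` of characteristic `p` taking a given nonzero
element to `1`. -/
theorem exists_addMonoidHom_pow_mul {K : Type*} [Field K] (q : ℕ) [Fact q.Prime] [CharP K q]
    (e : ℕ) {c : K} (hc : c ≠ 0) :
    ∃ π : K →+ K, π c = 1 ∧ ∀ x y, π (x ^ q ^ e * y) = x * π y := by
  have hker : LinearMap.ker (frobeniusLambda q c e) = ⊥ := by
    rw [LinearMap.ker_eq_bot']
    intro m hm
    have : m ^ q ^ e * c = 0 := hm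
    exact eq_zero_of_pow_eq_zero ((mul_eq_zero.1 this).resolve_right hc)
  -- Any injection of vector spaces splits, so K need not be F-finite.
  obtain ⟨g, hg⟩ := LinearMap.exists_leftInverse_of_injective _ hker
  refine ⟨g.toAddMonoidHom.comp (FrobeniusPushforward.of q e).toAddMonoidHom, ?_, fun x y => ?_⟩
  · simpa using FrobeniusPushforward.exists_map_smul_eq g hg 1
  · exact g.map_smul x (FrobeniusPushforward.of q e y)

namespace AddSubmonoid

variable {L : Type*} [AddCommGroup L] {S : AddSubmonoid L}

/-- The map `u ↦ N • u + s` on a submonoid. -/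
def nsmulAdd (s : S) (N : ℕ) (u : S) : S := N • u + s

theorem nsmulAdd_injective [IsAddTorsionFree L] (s : S) {N : ℕ} (hN : N ≠ 0) :
    Function.Injective (nsmulAdd s N) := by
  intro u v huv
  have : N • (u : L) + s = N • (v : L) + s := congrArg Subtype.val huv
  exact Subtype.ext (nsmul_right_injective hN (add_right_cancel this))

end AddSubmonoid

open AddSubmonoid in
/-- The additive map `K[S] → K[S]` whose value at `f` has `u`-th coefficient `π (f (N u + s))`. -/
noncomputable def AddMonoidAlgebra.trace {L : Type*} [AddCommGroup L] [IsAddTorsionFree L]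
    {S : AddSubmonoid L} {K : Type*} [Field K] (π : K →+ K) (s : S) {N : ℕ} (hN : N ≠ 0) :
    AddMonoidAlgebra K S →+ AddMonoidAlgebra K S where
  toFun f := .ofCoeff ((f.coeff.comapDomain (nsmulAdd s N)
    (nsmulAdd_injective s hN).injOn).mapRange π π.map_zero)
  map_zero' := by ext; simp
  map_add' f g := by ext; simp

section Trace

variable {L : Type*} [AddCommGroup L] [IsAddTorsionFree L] {S : AddSubmonoid L} {K : Type*}
  [Field K] {π : K →+ K} {s : S} {N : ℕ}

theorem AddMonoidAlgebra.coeff_trace (hN : N ≠ 0) (f : AddMonoidAlgebra K S) (u : S) :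
    (trace π s hN f).coeff u = π (f.coeff (N • u + s)) := rfl

/-- Root closure is what gives linearity: if Nu + s = Na + t with t ∈ S, then N(u - a) + s ∈ S, so u
∈ a + S. -/
theorem AddMonoidAlgebra.trace_single_pow_mul_single (hN : N ≠ 0) (hs : S.RootClosedAt s N)
    (hπ : ∀ x y, π (x ^ N * y) = x * π y) (a t : S) (x y : K) :
    trace π s hN (single a x ^ N * single t y) = single a x * trace π s hN (single t y) := by
  classical
  ext u
  rw [coeff_trace, single_pow, single_mul_single, coeff_single]
  by_cases hu : ∃ d, u = a + d
  · obtain ⟨d, rfl⟩ := hu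
    rw [coeff_single_mul_add, coeff_trace, coeff_single, Finsupp.single_apply,
      Finsupp.single_apply, nsmul_add, add_assoc]
    simp only [add_right_inj]
    split_ifs <;> simp [hπ]
  · rw [coeff_single_mul_of_forall_add_ne _ _ fun d hd => hu ⟨d, hd.symm⟩,
      Finsupp.single_eq_of_ne, map_zero]
    intro heq
    have heq' : N • (u : L) + s = N • (a : L) + t := congrArg Subtype.val heq
    have hmem : (u : L) - a ∈ S := by
      refine hs _ (sub_mem (AddSubgroup.subset_closure u.2) (AddSubgroup.subset_closure a.2)) ?_
      rw [nsmul_sub, sub_add_eq_add_sub, heq', add_sub_cancel_left]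
      exact t.2
    exact hu ⟨⟨_, hmem⟩, Subtype.ext (by simp)⟩

end Trace

/-- The trace sends c to 1: only the exponent s itself survives, and π is normalised to take its
coefficient to 1. -/
theorem AddMonoidAlgebra.exists_frobenius_splitting {L : Type*} [AddCommGroup L]
    [IsAddTorsionFree L] {S : AddSubmonoid L} {q : ℕ} [Fact q.Prime] {K : Type*} [Field K]
    [CharP K q] (c : AddMonoidAlgebra K S) (s : S) (hsc : c.coeff s ≠ 0) (e : ℕ)
    (hs : S.RootClosedAt s (q ^ e))
    (hc : ∀ u : S, u ≠ 0 → c.coeff (q ^ e • u + s) = 0) :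
    ∃ φ : FrobeniusPushforward (AddMonoidAlgebra K S) q e →ₗ[AddMonoidAlgebra K S]
      AddMonoidAlgebra K S, φ ∘ₗ frobeniusLambda q c e = LinearMap.id := by
  obtain ⟨π, hπc, hπ⟩ := exists_addMonoidHom_pow_mul q e hsc
  have hN : q ^ e ≠ 0 := (pow_pos (Fact.out : q.Prime).pos e).ne'
  have hlin (r f : AddMonoidAlgebra K S) :
      trace π s hN (r ^ q ^ e * f) = r * trace π s hN f := by
    have hadd (x y : AddMonoidAlgebra K S) : (x + y) ^ q ^ e = x ^ q ^ e + y ^ q ^ e :=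
      add_pow_char_pow _ _ _ _
    induction r using AddMonoidAlgebra.induction_linear with
    | zero => simp [zero_pow hN]
    | add r r' h h' => rw [hadd, add_mul, map_add, h, h', add_mul]
    | single a x =>
      induction f using AddMonoidAlgebra.induction_linear with
      | zero => simp
      | add f f' h h' => rw [mul_add, map_add, h, h', map_add, mul_add]
      | single t y => exact trace_single_pow_mul_single hN hs hπ a t x y
  let φ : FrobeniusPushforward (AddMonoidAlgebra K S) q e →ₗ[AddMonoidAlgebra K S]
      AddMonoidAlgebra K S :=
    { toFun := fun f => trace π s hN ((FrobeniusPushforward.of q e).symm f)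
      map_add' := fun f g => map_add (trace π s hN) _ _
      map_smul' := fun r f => hlin r _ }
  refine ⟨φ, LinearMap.ext_ring ?_⟩
  have h1 : φ (frobeniusLambda q c e 1) = trace π s hN (1 ^ q ^ e * c) := rfl
  rw [LinearMap.comp_apply, h1, one_pow, one_mul, LinearMap.id_apply]
  classical
  ext u
  rw [coeff_trace, one_def, coeff_single, Finsupp.single_apply]
  split_ifs with hu
  · rw [← hu, nsmul_zero, zero_add, hπc]
  · rw [hc u fun h => hu h.symm, map_zero]

/-- In a free abelian group, a finite set contains no nontrivial `N • u + s` once `N` is large. -/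
theorem exists_bound_nsmul_add_notMem {L : Type*} [AddCommGroup L] [Module.Free ℤ L]
    (A : Finset L) (s : L) : ∃ B : ℕ, ∀ N, B ≤ N → ∀ u : L, u ≠ 0 → N • u + s ∉ A := by
  let b := Module.Free.chooseBasis ℤ L
  let f (t : L) : ℕ := (b.repr (t - s)).sum fun _ z => z.natAbs
  refine ⟨A.sup f + 1, fun N hN u hu hmem => ?_⟩
  obtain ⟨i, hi⟩ : ∃ i, b.repr u i ≠ 0 := by
    by_contra! h
    exact hu (b.repr.map_eq_zero_iff.1 (Finsupp.ext h))
  have h1 : f (N • u + s) < N := (Finset.le_sup (f := f) hmem).trans_lt (by omega)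
  have h2 : (b.repr (N • u) i).natAbs ≤ f (N • u + s) := by
    simp only [f, add_sub_cancel_right]
    by_cases h0 : b.repr (N • u) i = 0
    · rw [h0, Int.natAbs_zero]
      exact Nat.zero_le _
    · exact Finset.single_le_sum (f := fun i => (b.repr (N • u) i).natAbs)
        (fun _ _ => Nat.zero_le _) (Finsupp.mem_support_iff.2 h0)
  rw [map_nsmul, Finsupp.smul_apply, nsmul_eq_mul, Int.natAbs_mul, Int.natAbs_natCast] at h2
  have h3 : N * 1 ≤ N * (b.repr u i).natAbs :=
    Nat.mul_le_mul_left _ (Int.natAbs_pos.2 hi)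
  omega

theorem AddMonoidAlgebra.isSplitFRegular_of_rootClosedAt {L : Type*} [AddCommGroup L]
    [Module.Free ℤ L] {S : AddSubmonoid L} (hS : ∀ s ∈ S, ∃ N, 0 < N ∧ S.RootClosedAt s N)
    (q : ℕ) [Fact q.Prime] (K : Type*) [Field K] [CharP K q] :
    IsSplitFRegular (AddMonoidAlgebra K S) q := by
  have : IsAddTorsionFree L := Module.isTorsionFree_int_iff_isAddTorsionFree.1 inferInstance
  let b := Module.Free.chooseBasis ℤ L
  have : TwoUniqueSums S := .of_injective_addHom
    (b.repr.toAddEquiv.toAddMonoidHom.comp S.subtype).toAddHom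
    (b.repr.injective.comp S.subtype_injective) inferInstance
  refine ⟨NoZeroDivisors.to_isDomain _, fun c hc => ?_⟩
  obtain ⟨s, hsc⟩ : ∃ s, c.coeff s ≠ 0 := by
    by_contra! h
    exact hc (by ext u; exact h u)
  obtain ⟨N, -, hN⟩ := hS s s.2
  classical
  obtain ⟨B, hB⟩ := exists_bound_nsmul_add_notMem (c.coeff.support.image Subtype.val) (s : L)
  have hq : 1 < q := (Fact.out : q.Prime).one_lt
  have hlt : N + B + 1 < q ^ (N + B + 1) := Nat.lt_pow_self hq
  -- Since q^e > e, this e puts q^e above both the root-closure bound N and the support bound B.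
  refine ⟨N + B + 1, by omega, exists_frobenius_splitting c s hsc _
    (hN.mono hS s.2 (by omega) (by omega)) fun u hu => ?_⟩
  by_contra hne
  exact hB _ (by omega) (u : L) (by simpa using hu)
    (Finset.mem_image.2 ⟨_, Finsupp.mem_support_iff.2 hne, rfl⟩)

theorem mainTheorem5 {L : Type*} [AddCommGroup L] [Module.Free ℤ L] [Module.Finite ℤ L]
    (S : AddSubmonoid L)
    (p : ℕ) [Fact p.Prime] (k : Type*) [Field k] [CharP k p]
    (h : IsSplitFRegular (AddMonoidAlgebra k S) p)
    (q : ℕ) [Fact q.Prime] (K : Type*) [Field K] [CharP K q] :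
    IsNoetherianRing (AddMonoidAlgebra K S) ∧ IsSplitFRegular (AddMonoidAlgebra K S) q := by
  have hS := h.exists_rootClosedAt
  have : AddMonoid.FG S := (AddMonoid.fg_iff_addSubmonoid_fg S).2 (S.fg_of_rootClosedAt hS)
  exact ⟨Algebra.FiniteType.isNoetherianRing K _, isSplitFRegular_of_rootClosedAt hS q K⟩
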